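/- Let $g:\mathbb R\to\mathbb R$ be nondecreasing and left-continuous, and let $\mu_g$ be its Lebesgue–Stieltjes measure, $\mu_g([c,d))=g(d)-g(c)$. Put $\Delta g(t)=g(t^+)-g(t)$, $D_g=\{t:\Delta g(t)>0\}$, and let $C_g$ be the open set of all $t$ such that $g$ is constant on a neighbourhood of $t$. Let $N_g^-$ and $N_g^+$ be the sets of the finite left, respectively right, endpoints of the connected components of $C_g$ that do not belong to $D_g$. Let $T>0$ with $0\notin D_g\cup N_g^-$ and $T\notin N_g^+\cup D_g\cup C_g$. For $t\in[0,T]$ let $t^*=t$ if $t\notin C_g$, and let $t^*$ be the right endpoint of the component of $C_g$ that contains $t$ if $t\in C_g$. The $g$-derivative of $f:[0,T]\to\mathbb C$ at $t$ is $$f_g'(t)=\lim_{s\to t}\frac{f(s)-f(t)}{g(s)-g(t)}\ \ (t\notin D_g\cup C_g),\qquad f_g'(t)=\lim_{s\to t^{*+}}\frac{f(s)-f(t^*)}{g(s)-g(t^*)}\ \ (t\in D_g\cup C_g),$$ if the limit exists, where the first limit is taken over $s\in[0,T]$ with $g(s)\ne g(t)$. A function $f:[0,T]\to\mathbb C$ is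 $g$-continuous if for all $t\in[0,T]$ and $\varepsilon>0$ there is $\delta>0$ such that $|f(t)-f(s)|<\varepsilon$ for all $s\in[0,T]$ with $|g(t)-g(s)|<\delta$. $\mathcal{BC}_g$ is the set of bounded $g$-continuous functions $[0,T]\to\mathbb C$, and $\mathcal{BC}_g^2$ is the set of all $f\in\mathcal{BC}_g$ for which $f_g'$ and $f_g''=(f_g')_g'$ exist everywhere on $[0,T]$ and belong to $\mathcal{BC}_g$. A function $p:[0,T]\to\mathbb C$ is regressive if $1+p(t)\Delta g(t)\ne0$ for all $t\in[0,T]\cap D_g$. For regressive $p\in\mathcal L^1_g([0,T);\mathbb C)$ let $$\exp_g(p;t)=\exp\Big(\int_{[0,t)}\tilde p\,d\mu_g\Big),\quad t\in[0,T],$$ where $\tilde p(s)=p(s)$ for $s\notin D_g$ and $\tilde p(s)=\ln(1+p(s)\Delta g(s))/\Delta g(s)$ for $s\in D_g$, with the principal logarithm. Let $P,Q\in\mathcal{BC}_g$ and let $y_1,y_2\in\mathcal{BC}_g^2$ be two solutions of $v_g''(t)+P(t)v_g'(t)+Q(t)v(t)=0$, $t\in[0,T]$. Put $$W_g(y_1,y_2)=\begin{vmatrix}y_1&y_2&(\Delta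 g)^2\\(y_1)_g'&(y_2)_g'&-\Delta g\\(y_1)_g''&(y_2)_g''&1\end{vmatrix},\qquad \widetilde W_g(y_1,y_2)=\begin{vmatrix}y_1&y_2\\(y_1)_g'&(y_2)_g'\end{vmatrix}.$$ Then, on $[0,T]$, $$W_g(y_1,y_2)=(1-P\Delta g+Q(\Delta g)^2)\,\widetilde W_g(y_1,y_2).$$ Suppose moreover that $1-P(t)\Delta g(t)+Q(t)\Delta g(t)^2\neq0$ for all $t\in[0,T]\cap D_g$. Then $-P+Q\Delta g$ is regressive and belongs to $\mathcal L^1_g([0,T);\mathbb C)$, the integral that defines its $g$-exponential converges absolutely, and, on $[0,T]$, $$\widetilde W_g(y_1,y_2)=\widetilde W_g(y_1,y_2)(0)\,\exp_g(-P+Q\Delta g;\cdot).$$ If in addition $\widetilde W_g(y_1,y_2)(0)\ne0$, then $W_g(y_1,y_2)(t)\ne0$ for every $t\in[0,T]$, the function $-\frac{-P+Q\Delta g}{1-P\Delta g+Q(\Delta g)^2}$ is likewise regressive and in $\mathcal L^1_g([0,T);\mathbb C)$ with an absolutely convergent integral in its $g$-exponential, and, on $[0,T]$, $$W_g(y_1,y_2)^{-1}=\big[\widetilde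 W_g(y_1,y_2)(0)\,(1-P\Delta g+Q(\Delta g)^2)\big]^{-1}\exp_g\Big(-\frac{-P+Q\Delta g}{1-P\Delta g+Q(\Delta g)^2};\cdot\Big);$$ this function is bounded on $[0,T]$ and continuous (in the usual sense, as a function on $[0,T]$) at every point of $[0,T]\setminus D_g$. -/

import Mathlib

open Set Filter Topology MeasureTheory

/-- A derivator: a nondecreasing, left-continuous function `g : ℝ → ℝ`. -/
structure Derivator where
  toFun : ℝ → ℝ
  mono : Monotone toFun
  leftCont : ∀ t, ContinuousWithinAt toFun (Iic t) t

namespace Derivator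

instance : CoeFun Derivator (fun _ => ℝ → ℝ) := ⟨Derivator.toFun⟩

/-- The Lebesgue–Stieltjes measure `μ_g`, with `μ_g [c,d) = g d - g c` (see `mu_Ico`).
Mathlib's Stieltjes functions are right-continuous, so it is built from `t ↦ g (t⁺)`. -/
noncomputable def mu (g : Derivator) : Measure ℝ := g.mono.stieltjesFunction.measure

theorem mu_Ico (g : Derivator) (c d : ℝ) : g.mu (Ico c d) = ENNReal.ofReal (g d - g c) := by
  have key : ∀ x, Function.leftLim g.mono.stieltjesFunction x = g x := by
    intro x
    have h1 : Function.leftLim (g.toFun) x = g x :=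
      (g.mono.continuousWithinAt_Iio_iff_leftLim_eq).1
        ((g.leftCont x).mono Iio_subset_Iic_self)
    have h2 : Function.leftLim (Function.rightLim g.toFun) x = Function.leftLim g.toFun x :=
      leftLim_rightLim (g.mono.tendsto_leftLim x)
    rw [← h1, ← h2]
    congr 1
  rw [mu, StieltjesFunction.measure_Ico, key, key]

/-- The jump `Δg(t) = g(t⁺) - g(t)`. -/
noncomputable def jump (g : Derivator) (t : ℝ) : ℝ := Function.rightLim g.toFun t - g t

/-- `C_g`: the points around which `g` is constant. -/
def constSet (g : Derivator) : Set ℝ :=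
  {t | ∃ ε > 0, ∀ s ∈ Ioo (t - ε) (t + ε), g s = g t}

/-- `D_g`: the discontinuity points of `g`. -/
def jumpSet (g : Derivator) : Set ℝ := {t | 0 < g.jump t}

/-- `N_g⁻`: the (finite) left endpoints of the connected components of the open set `C_g`
that do not belong to `D_g`. -/
def leftEnds (g : Derivator) : Set ℝ :=
  {a | a ∉ g.constSet ∧ ∃ b > a, Ioo a b ⊆ g.constSet} \ g.jumpSet

/-- `N_g⁺`: the (finite) right endpoints of the connected components of the open set `C_g`
that do not belong to `D_g`. -/
def rightEnds (g : Derivator) : Set ℝ :=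
  {b | b ∉ g.constSet ∧ ∃ a < b, Ioo a b ⊆ g.constSet} \ g.jumpSet

open Classical in
/-- `t*`: equal to `t` if `t ∉ C_g`, and to the right endpoint of the connected component of
`C_g` that contains `t` if `t ∈ C_g` (see `star_eq`). -/
noncomputable def star (g : Derivator) (t : ℝ) : ℝ :=
  if t ∈ g.constSet then sInf {s | t ≤ s ∧ s ∉ g.constSet} else t

theorem star_eq (g : Derivator) {a b t : ℝ} (hab : Ioo a b ⊆ g.constSet)
    (hb : b ∉ g.constSet) (ht : t ∈ Ioo a b) : g.star t = b := by
  have hl : IsLeast {s | t ≤ s ∧ s ∉ g.constSet} b :=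
    ⟨⟨ht.2.le, hb⟩, fun s hs => not_lt.1 fun h => hs.2 (hab ⟨ht.1.trans_le hs.1, h⟩)⟩
  rw [star, if_pos (hab ht)]
  exact hl.csInf_eq

open Classical in
/-- The filter along which the limit defining the `g`-derivative at `t` of a function on `[0,T]`
is taken: `s → t*` from the right if `t ∈ D_g ∪ C_g`, and otherwise `s → t` with `s ∈ [0,T]`,
`g s ≠ g t`, the set where the quotient is defined (this is a one-sided limit at points of
`N_g⁻ ∪ N_g⁺ ∪ {0, T}`). -/
noncomputable def derivFilter (g : Derivator) (T t : ℝ) : Filter ℝ :=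
  if t ∈ g.jumpSet ∪ g.constSet then 𝓝[Ioc (g.star t) T] (g.star t)
  else 𝓝[{s | s ∈ Icc 0 T ∧ g s ≠ g t}] t

/-- The difference quotient of `f` with respect to `g` at `t*`. -/
noncomputable def quot (g : Derivator) (f : ℝ → ℂ) (t s : ℝ) : ℂ :=
  (f s - f (g.star t)) / ((g s - g (g.star t) : ℝ) : ℂ)

/-- `f : [0,T] → ℂ` is `g`-differentiable at `t`. Functions on `[0,T]` are represented by functions
on `ℝ`, of which only the values on `[0,T]` matter. -/
def DiffAt (g : Derivator) (T : ℝ) (f : ℝ → ℂ) (t : ℝ) : Prop :=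
  ∃ d : ℂ, Tendsto (g.quot f t) (g.derivFilter T t) (𝓝 d)

/-- The `g`-derivative of `f : [0,T] → ℂ`. -/
noncomputable def deriv (g : Derivator) (T : ℝ) (f : ℝ → ℂ) (t : ℝ) : ℂ :=
  limUnder (g.derivFilter T t) (g.quot f t)

/-- The iterated `g`-derivative `f_g^{(n)}` on `[0,T]`. -/
noncomputable def iterDeriv (g : Derivator) (T : ℝ) : ℕ → (ℝ → ℂ) → ℝ → ℂ
  | 0, f => f
  | n + 1, f => g.deriv T (iterDeriv g T n f)

/-- `f ∈ C_g([0,T]; ℂ)`: `f` is `g`-continuous on `[0,T]`. -/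
def MemC (g : Derivator) (T : ℝ) (f : ℝ → ℂ) : Prop :=
  ∀ t ∈ Icc 0 T, ∀ ε > 0, ∃ δ > 0, ∀ s ∈ Icc 0 T, |g t - g s| < δ → ‖f t - f s‖ < ε

/-- `f ∈ BC_g([0,T]; ℂ)`: `f` is `g`-continuous and bounded on `[0,T]`. -/
def MemBC (g : Derivator) (T : ℝ) (f : ℝ → ℂ) : Prop :=
  g.MemC T f ∧ ∃ M : ℝ, ∀ t ∈ Icc 0 T, ‖f t‖ ≤ M

/-- `f ∈ C_g^k([0,T]; ℂ)`. -/
def MemCk (g : Derivator) (T : ℝ) : ℕ → (ℝ → ℂ) → Prop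
  | 0, f => g.MemC T f
  | k + 1, f => MemCk g T k f ∧ (∀ t ∈ Icc 0 T, g.DiffAt T (g.iterDeriv T k f) t) ∧
      g.MemC T (g.iterDeriv T (k + 1) f)

/-- `f ∈ BC_g^k([0,T]; ℂ)`. -/
def MemBCk (g : Derivator) (T : ℝ) (k : ℕ) (f : ℝ → ℂ) : Prop :=
  g.MemCk T k f ∧ ∀ n ≤ k, g.MemBC T (g.iterDeriv T n f)

/-- `p` is regressive on `[0,T]`. -/
def Regressive (g : Derivator) (T : ℝ) (p : ℝ → ℂ) : Prop :=
  ∀ t ∈ Icc 0 T ∩ g.jumpSet, 1 + p t * g.jump t ≠ 0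

open Classical in
/-- The function `p̃` in the definition of the `g`-exponential. -/
noncomputable def expIntegrand (g : Derivator) (p : ℝ → ℂ) (s : ℝ) : ℂ :=
  if s ∈ g.jumpSet then Complex.log (1 + p s * g.jump s) / g.jump s else p s

/-- The `g`-exponential `exp_g(p; t) = exp (∫_{[0,t)} p̃ dμ_g)`. -/
noncomputable def gexp (g : Derivator) (p : ℝ → ℂ) (t : ℝ) : ℂ :=
  Complex.exp (∫ s in Ico 0 t, g.expIntegrand p s ∂g.mu)

/-- The `g`-exponential of `p` on `[0,T]` is well defined: `p` is regressive and belongs to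
`L¹_g([0,T); ℂ)`, and the integral in the definition of `gexp` converges absolutely. -/
def GexpDefined (g : Derivator) (T : ℝ) (p : ℝ → ℂ) : Prop :=
  g.Regressive T p ∧ IntegrableOn p (Ico 0 T) g.mu ∧
    IntegrableOn (g.expIntegrand p) (Ico 0 T) g.mu

/-- `v` is a solution of `v_g'' + P v_g' + Q v = f` on `[0,T]`. -/
def IsSolution (g : Derivator) (T : ℝ) (P Q f v : ℝ → ℂ) : Prop :=
  g.MemBCk T 2 v ∧
    ∀ t ∈ Icc 0 T, g.iterDeriv T 2 v t + P t * g.iterDeriv T 1 v t + Q t * v t = f t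

/-- The `g`-Wronskian `W_g(y₁,y₂)`. -/
noncomputable def wronskian (g : Derivator) (T : ℝ) (y₁ y₂ : ℝ → ℂ) (t : ℝ) : ℂ :=
  Matrix.det !![y₁ t, y₂ t, (g.jump t : ℂ) ^ 2;
    g.iterDeriv T 1 y₁ t, g.iterDeriv T 1 y₂ t, -(g.jump t : ℂ);
    g.iterDeriv T 2 y₁ t, g.iterDeriv T 2 y₂ t, 1]

/-- The simplified `g`-Wronskian `W̃_g(y₁,y₂)`. -/
noncomputable def simpleWronskian (g : Derivator) (T : ℝ) (y₁ y₂ : ℝ → ℂ) (t : ℝ) : ℂ :=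
  Matrix.det !![y₁ t, y₂ t; g.iterDeriv T 1 y₁ t, g.iterDeriv T 1 y₂ t]

end Derivator

/-!
By the product rule, the simplified Wronskian solves the first-order equation
`f_g' = (-P + Q Δg) f`. For such an equation only right `g`-derivatives on `[0,T)` matter, and they
say nothing where `g` is constant immediately to the right, so that `t*` disappears from the
argument; by real induction, a `g`-continuous function with zero right `g`-derivative is constant.

With `λ z = log (1 + z) / z`, `λ 0 = 1`, the integrand of `exp_g(p)` is `p · λ(p Δg)`. If `p` is
integrable, then `|p Δg|` exceeds any given positive constant at only finitely many points, so
`λ(p Δg)` is bounded and the integral converges. When `p` is moreover right-continuous off the jumps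
of `g` and regressive, `exp_g(p)` solves `f_g' = p f`. Multiplying any solution of this equation by
`exp_g(⊖p)`, where `⊖p = -p / (1 + p Δg)`, gives a function with zero derivative, and therefore
`f = f(0) exp_g(p)` and `exp_g(⊖p) = 1 / exp_g(p)`.
-/

theorem real_induction_Icc {α : Type*} [ConditionallyCompleteLinearOrder α]
    [TopologicalSpace α] [OrderTopology α] {a b : α} {p : α → Prop}
    (hleft : ∀ x ∈ Icc a b, (∀ s ∈ Ico a x, p s) → p x)
    (hright : ∀ x ∈ Ico a b, p x → ∀ᶠ s in 𝓝[>] x, p s) : ∀ x ∈ Icc a b, p x := by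
  intro x hx
  by_contra hpx
  set bad := {y | y ∈ Icc a b ∧ ¬p y}
  have hbdd : BddBelow bad := ⟨a, fun y hy => hy.1.1⟩
  have hne : bad.Nonempty := ⟨x, hx, hpx⟩
  have ha : a ≤ sInf bad := le_csInf hne fun y hy => hy.1.1
  have hle : sInf bad ≤ x := csInf_le hbdd ⟨hx, hpx⟩
  have hp : p (sInf bad) := hleft _ ⟨ha, hle.trans hx.2⟩ fun s hs =>
    by_contra fun hps => notMem_of_lt_csInf hs.2 hbdd ⟨⟨hs.1, hs.2.le.trans (hle.trans hx.2)⟩, hps⟩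
  have hlt : sInf bad < x := hle.lt_of_ne fun h => hpx (h ▸ hp)
  obtain ⟨u, hu, hup⟩ := (mem_nhdsGT_iff_exists_Ioo_subset' hlt).1
    (hright _ ⟨ha, hlt.trans_le hx.2⟩ hp)
  obtain ⟨y, hy, hyu⟩ := exists_lt_of_csInf_lt hne (mem_Ioi.1 hu)
  have hne' : sInf bad ≠ y := fun h => hy.2 (h ▸ hp)
  exact hy.2 (hup ⟨(csInf_le hbdd hy).lt_of_ne hne', hyu⟩)

theorem norm_sub_le_sub_of_eventually_nhdsGT {E : Type*} [SeminormedAddCommGroup E]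
    {f : ℝ → E} {h : ℝ → ℝ} {a b : ℝ} (hf : ∀ x ∈ Ioc a b, ContinuousWithinAt f (Iio x) x)
    (hh : ∀ x ∈ Ioc a b, ContinuousWithinAt h (Iio x) x)
    (hfh : ∀ x ∈ Ico a b, ∀ᶠ s in 𝓝[>] x, ‖f s - f x‖ ≤ h s - h x) :
    ∀ x ∈ Icc a b, ‖f x - f a‖ ≤ h x - h a := by
  refine real_induction_Icc (fun x hx hlt => ?_) fun x hx hle => ?_
  · rcases hx.1.eq_or_lt with rfl | hax
    · simp
    · refine le_of_tendsto_of_tendsto ((hf x ⟨hax, hx.2⟩).sub_const _).norm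
        ((hh x ⟨hax, hx.2⟩).sub_const _) ?_
      filter_upwards [Ico_mem_nhdsLT hax] using hlt
  · filter_upwards [hfh x hx] with s hs
    linarith [norm_sub_le_norm_sub_add_norm_sub (f s) (f x) (f a)]

theorem tendsto_setIntegral_of_subset {α ι E : Type*} [MeasurableSpace α] {μ : Measure α}
    [NormedAddCommGroup E] [NormedSpace ℝ E] {f : α → E} {A : Set α} {S : ι → Set α}
    {l : Filter ι} (hf : IntegrableOn f A μ) (hS : ∀ᶠ i in l, S i ⊆ A)
    (hμ : Tendsto (fun i => μ (S i)) l (𝓝 0)) :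
    Tendsto (fun i => ∫ x in S i, f x ∂μ) l (𝓝 0) := by
  have hμA : Tendsto (fun i => μ.restrict A (S i)) l (𝓝 0) :=
    tendsto_of_tendsto_of_tendsto_of_le_of_le tendsto_const_nhds hμ (fun _ => zero_le)
      fun i => Measure.restrict_apply_le A (S i)
  refine (Integrable.tendsto_setIntegral_nhds_zero hf hμA).congr' ?_
  filter_upwards [hS] with i hi
  rw [Measure.restrict_restrict_of_subset hi]

namespace Derivator

section Jumps

variable (g : Derivator) {t : ℝ}

theorem jump_nonneg (t : ℝ) : 0 ≤ g.jump t :=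
  sub_nonneg.2 (g.mono.le_rightLim le_rfl)

theorem jump_le_sub {s : ℝ} (hts : t < s) : g.jump t ≤ g s - g t :=
  sub_le_sub_right (g.mono.rightLim_le hts) _

theorem norm_ofReal_jump (t : ℝ) : ‖(g.jump t : ℂ)‖ = g.jump t :=
  Complex.norm_of_nonneg (g.jump_nonneg t)

variable {g} in
theorem ofReal_jump_eq_zero (ht : t ∉ g.jumpSet) : (g.jump t : ℂ) = 0 :=
  Complex.ofReal_eq_zero.2 (le_antisymm (not_lt.1 ht) (g.jump_nonneg t))

variable {g} in
theorem ofReal_jump_ne_zero (ht : t ∈ g.jumpSet) : (g.jump t : ℂ) ≠ 0 :=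
  Complex.ofReal_ne_zero.2 (ne_of_gt ht)

theorem measurable_ofReal_jump : Measurable fun t => (g.jump t : ℂ) :=
  Complex.measurable_ofReal.comp (g.mono.rightLim.measurable.sub g.mono.measurable)

theorem leftLim_eq (t : ℝ) : Function.leftLim g.toFun t = g t :=
  g.mono.continuousWithinAt_Iio_iff_leftLim_eq.1 ((g.leftCont t).mono Iio_subset_Iic_self)

theorem leftLim_rightLim_eq (t : ℝ) : Function.leftLim (Function.rightLim g.toFun) t = g t := by
  rw [leftLim_rightLim (g.mono.tendsto_leftLim t), leftLim_eq]

theorem tendsto_nhdsGT (t : ℝ) : Tendsto g.toFun (𝓝[>] t) (𝓝 (g t + g.jump t)) := by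
  rw [jump, add_sub_cancel]
  exact g.mono.tendsto_rightLim t

variable {g} in
theorem continuousAt_of_notMem_jumpSet (ht : t ∉ g.jumpSet) : ContinuousAt g.toFun t := by
  rw [g.mono.continuousAt_iff_leftLim_eq_rightLim, leftLim_eq]
  exact (sub_eq_zero.1 (Complex.ofReal_eq_zero.1 (ofReal_jump_eq_zero ht))).symm

variable {g} in
theorem continuousAt_ofReal_jump (ht : t ∉ g.jumpSet) :
    ContinuousAt (fun s => (g.jump s : ℂ)) t := by
  have hright : ContinuousAt (Function.rightLim g.toFun) t := by
    rw [g.mono.rightLim.continuousAt_iff_leftLim_eq_rightLim, leftLim_rightLim_eq,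
      rightLim_rightLim (g.mono.tendsto_rightLim t)]
    exact (sub_eq_zero.1 (Complex.ofReal_eq_zero.1 (ofReal_jump_eq_zero ht))).symm
  exact Complex.continuous_ofReal.continuousAt.comp
    (hright.sub (continuousAt_of_notMem_jumpSet ht))

instance : IsLocallyFiniteMeasure g.mu :=
  inferInstanceAs (IsLocallyFiniteMeasure g.mono.stieltjesFunction.measure)

theorem mu_singleton (t : ℝ) : g.mu {t} = ENNReal.ofReal (g.jump t) := by
  rw [mu, StieltjesFunction.measure_singleton, jump, ← g.leftLim_rightLim_eq t]
  rfl

theorem mu_Ioo (t s : ℝ) : g.mu (Ioo t s) = ENNReal.ofReal (g s - (g t + g.jump t)) := by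
  rw [mu, StieltjesFunction.measure_Ioo, jump, add_sub_cancel, ← g.leftLim_rightLim_eq s]
  rfl

theorem measureReal_mu_Ico {s : ℝ} (hts : t ≤ s) : g.mu.real (Ico t s) = g s - g t := by
  rw [measureReal_def, mu_Ico, ENNReal.toReal_ofReal (sub_nonneg.2 (g.mono hts))]

theorem tendsto_mu_Ioo_nhdsGT (t : ℝ) : Tendsto (fun s => g.mu (Ioo t s)) (𝓝[>] t) (𝓝 0) := by
  simp only [mu_Ioo]
  refine (ENNReal.continuous_ofReal.tendsto' 0 0 ENNReal.ofReal_zero).comp ?_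
  simpa only [sub_self] using (g.tendsto_nhdsGT t).sub_const (g t + g.jump t)

end Jumps

section GContinuity

variable {g : Derivator} {T t : ℝ} {f h : ℝ → ℂ}

theorem memC_iff_tendsto : g.MemC T f ↔
    ∀ t ∈ Icc 0 T, Tendsto f (comap g.toFun (𝓝 (g t)) ⊓ 𝓟 (Icc 0 T)) (𝓝 (f t)) := by
  refine forall₂_congr fun t _ => ?_
  rw [((Metric.nhds_basis_ball.comap g.toFun).inf_principal (Icc 0 T)).tendsto_iff
    Metric.nhds_basis_ball]
  refine forall₂_congr fun ε _ => exists_congr fun δ => and_congr_right fun _ => ?_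
  refine forall_congr' fun s => ?_
  rw [mem_inter_iff, mem_preimage, Metric.mem_ball', Metric.mem_ball', Real.dist_eq, dist_eq_norm,
    and_comm, and_imp]

namespace MemC

theorem mul (hf : g.MemC T f) (hh : g.MemC T h) : g.MemC T fun t => f t * h t :=
  memC_iff_tendsto.2 fun t ht => (memC_iff_tendsto.1 hf t ht).mul (memC_iff_tendsto.1 hh t ht)

theorem sub (hf : g.MemC T f) (hh : g.MemC T h) : g.MemC T fun t => f t - h t :=
  memC_iff_tendsto.2 fun t ht => (memC_iff_tendsto.1 hf t ht).sub (memC_iff_tendsto.1 hh t ht)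

theorem comp_left {φ : ℂ → ℂ} (hφ : Continuous φ) (hf : g.MemC T f) :
    g.MemC T fun t => φ (f t) :=
  memC_iff_tendsto.2 fun t ht => (hφ.tendsto _).comp (memC_iff_tendsto.1 hf t ht)

theorem eq_of_eq (hf : g.MemC T f) {s : ℝ} (ht : t ∈ Icc 0 T) (hs : s ∈ Icc 0 T)
    (hst : g s = g t) : f s = f t := by
  refine (eq_of_forall_dist_le fun ε hε => ?_).symm
  obtain ⟨δ, hδ, hfδ⟩ := hf t ht ε hε
  rw [dist_eq_norm]
  exact (hfδ s hs (by simpa only [hst, sub_self, abs_zero] using hδ)).le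

theorem tendsto (hf : g.MemC T f) (ht : t ∈ Icc 0 T) {l : Filter ℝ}
    (hl : ∀ᶠ s in l, s ∈ Icc 0 T) (hg : Tendsto g.toFun l (𝓝 (g t))) : Tendsto f l (𝓝 (f t)) :=
  (memC_iff_tendsto.1 hf t ht).mono_left (le_inf hg.le_comap (le_principal_iff.2 hl))

theorem continuousWithinAt_Icc (hf : g.MemC T f) (ht : t ∈ Icc 0 T) (hj : t ∉ g.jumpSet) :
    ContinuousWithinAt f (Icc 0 T) t :=
  hf.tendsto ht self_mem_nhdsWithin (continuousAt_of_notMem_jumpSet hj).continuousWithinAt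

theorem continuousWithinAt_Ioi (hf : g.MemC T f) (ht : t ∈ Ico 0 T) (hj : t ∉ g.jumpSet) :
    ContinuousWithinAt f (Ioi t) t :=
  (hf.continuousWithinAt_Icc (Ico_subset_Icc_self ht) hj).mono_of_mem_nhdsWithin <|
    mem_of_superset (Ioo_mem_nhdsGT ht.2) fun _ hs => ⟨ht.1.trans hs.1.le, hs.2.le⟩

theorem continuousWithinAt_Iio (hf : g.MemC T f) (ht : t ∈ Ioc 0 T) :
    ContinuousWithinAt f (Iio t) t :=
  hf.tendsto (Ioc_subset_Icc_self ht)
    (mem_of_superset (Ioo_mem_nhdsLT ht.1) fun _ hs => ⟨hs.1.le, hs.2.le.trans ht.2⟩)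
    ((g.leftCont t).mono Iio_subset_Iic_self)

theorem aemeasurable (hf : g.MemC T f) : AEMeasurable f (g.mu.restrict (Icc 0 T)) := by
  -- On `[0,T]`, `g`-continuity is continuity for the topology induced by the monotone map `g`.
  let gT : Icc (0 : ℝ) T → ℝ := fun s => g s
  have hcont : Continuous[.induced gT inferInstance, _] fun s : Icc (0 : ℝ) T => f s := by
    let _ : TopologicalSpace (Icc (0 : ℝ) T) := .induced gT inferInstance
    refine continuous_iff_continuousAt.2 fun s => (memC_iff_tendsto.1 hf s s.2).comp ?_
    rw [nhds_induced]
    exact tendsto_inf.2 ⟨tendsto_comap_iff.2 tendsto_comap,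
      tendsto_principal.2 (Eventually.of_forall fun r => r.2)⟩
  have hgT : Measurable gT := g.mono.measurable.comp measurable_subtype_coe
  refine aemeasurable_restrict_of_measurable_subtype measurableSet_Icc
    (measurable_of_isOpen fun U hU => ?_)
  obtain ⟨V, hV, hVU⟩ := isOpen_induced_iff.1 (continuous_def.1 hcont U hU)
  exact hVU ▸ hgT hV.measurableSet

end MemC

end GContinuity

section RightDerivative

/-- The filter of right limits at `t` along the set where `s ↦ (f s - f t) / (g s - g t)` is
defined; `g t < g s` forces `t < s` by monotonicity. It is trivial if `g` is constant immediately
to the right of `t`. -/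
def rightFilter (g : Derivator) (t : ℝ) : Filter ℝ := 𝓝[{s | g t < g s}] t

/-- `f` has the right `g`-derivative `f'` at `t`. Nothing is required where `g` is constant
immediately to the right of `t`, so that `t*` plays no role. -/
def HasRightDeriv (g : Derivator) (f : ℝ → ℂ) (f' : ℂ) (t : ℝ) : Prop :=
  Tendsto (fun s => (f s - f t) / ((g s - g t : ℝ) : ℂ)) (g.rightFilter t) (𝓝 f')

variable {g : Derivator} {T t : ℝ} {f h : ℝ → ℂ} {f' h' : ℂ}

theorem rightFilter_le_nhdsGT : g.rightFilter t ≤ 𝓝[>] t :=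
  nhdsWithin_mono _ fun _ hs => g.mono.reflect_lt hs

theorem eventually_rightFilter_lt : ∀ᶠ s in g.rightFilter t, g t < g s :=
  self_mem_nhdsWithin

theorem eventually_rightFilter_sub_ne_zero :
    ∀ᶠ s in g.rightFilter t, ((g s - g t : ℝ) : ℂ) ≠ 0 :=
  eventually_rightFilter_lt.mono fun _ hs => Complex.ofReal_ne_zero.2 (sub_pos.2 hs).ne'

theorem tendsto_ofReal_sub_rightFilter :
    Tendsto (fun s => ((g s - g t : ℝ) : ℂ)) (g.rightFilter t) (𝓝 (g.jump t : ℂ)) := by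
  have hsub : Tendsto (fun s => g s - g t) (𝓝[>] t) (𝓝 (g.jump t)) := by
    simpa only [add_sub_cancel_left] using (g.tendsto_nhdsGT t).sub_const (g t)
  exact (Complex.continuous_ofReal.tendsto _).comp (hsub.mono_left rightFilter_le_nhdsGT)

namespace HasRightDeriv

theorem tendsto (hf : g.HasRightDeriv f f' t) :
    Tendsto f (g.rightFilter t) (𝓝 (f t + f' * g.jump t)) := by
  refine ((hf.mul tendsto_ofReal_sub_rightFilter).const_add (f t)).congr' ?_
  filter_upwards [eventually_rightFilter_sub_ne_zero] with s hs
  rw [div_mul_cancel₀ _ hs, add_sub_cancel]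

theorem of_tendsto (ht : t ∈ g.jumpSet)
    (hf : Tendsto f (𝓝[>] t) (𝓝 (f t + f' * g.jump t))) : g.HasRightDeriv f f' t := by
  have hjump := ofReal_jump_ne_zero ht
  have hquot := ((hf.mono_left rightFilter_le_nhdsGT).sub_const (f t)).div
    tendsto_ofReal_sub_rightFilter hjump
  rwa [add_sub_cancel_left, mul_div_cancel_right₀ _ hjump] at hquot

theorem mul (hf : g.HasRightDeriv f f' t) (hh : g.HasRightDeriv h h' t) :
    g.HasRightDeriv (fun s => f s * h s) (f' * (h t + h' * g.jump t) + f t * h') t :=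
  ((Tendsto.mul hf hh.tendsto).add (Tendsto.const_mul (f t) hh)).congr fun s => by ring

theorem sub (hf : g.HasRightDeriv f f' t) (hh : g.HasRightDeriv h h' t) :
    g.HasRightDeriv (fun s => f s - h s) (f' - h') t :=
  (Tendsto.sub hf hh).congr fun s => by ring

theorem comp_left_of_notMem_jumpSet {φ : ℂ → ℂ} {φ' : ℂ} (hφ : HasDerivAt φ φ' (f t))
    (hf : g.HasRightDeriv f f' t) (ht : t ∉ g.jumpSet) :
    g.HasRightDeriv (fun s => φ (f s)) (φ' * f') t := by
  have hft : Tendsto f (g.rightFilter t) (𝓝 (f t)) := by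
    simpa only [ofReal_jump_eq_zero ht, mul_zero, add_zero] using hf.tendsto
  have hslope := (continuousAt_dslope_same.2 hφ.differentiableAt).tendsto.comp hft
  rw [dslope_same, hφ.deriv] at hslope
  refine (hslope.mul hf).congr fun s => ?_
  rw [Function.comp_apply, ← sub_smul_dslope φ (f t) (f s), smul_eq_mul]
  ring

end HasRightDeriv

theorem rightFilter_eq_bot (ht : t ∈ g.constSet) : g.rightFilter t = ⊥ := by
  obtain ⟨ε, hε, hg⟩ := ht
  have hconst : ∀ᶠ s in 𝓝 t, g s = g t :=
    mem_of_superset (Ioo_mem_nhds (sub_lt_self t hε) (lt_add_of_pos_right t hε)) hg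
  rw [← eventually_false_iff_eq_bot]
  filter_upwards [eventually_rightFilter_lt, nhdsWithin_le_nhds hconst] with s hs hs'
  exact hs.ne' hs'

theorem DiffAt.hasRightDeriv (hf : g.DiffAt T f t) (ht : t ∈ Ico 0 T) :
    g.HasRightDeriv f (g.deriv T f t) t := by
  by_cases hc : t ∈ g.constSet
  · rw [HasRightDeriv, rightFilter_eq_bot hc]
    exact tendsto_bot
  have hstar : g.star t = t := if_neg hc
  have hle : g.rightFilter t ≤ g.derivFilter T t := by
    rw [derivFilter, hstar]
    split_ifs
    · rw [nhdsWithin_Ioc_eq_nhdsGT ht.2]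
      exact rightFilter_le_nhdsGT
    · have hIcc : ∀ᶠ s in g.rightFilter t, s ∈ Icc 0 T :=
        rightFilter_le_nhdsGT <| mem_of_superset (Ioo_mem_nhdsGT ht.2) fun s hs =>
          ⟨ht.1.trans hs.1.le, hs.2.le⟩
      refine le_inf nhdsWithin_le_nhds (le_principal_iff.2 ?_)
      filter_upwards [hIcc, eventually_rightFilter_lt] with s hs hlt
      exact ⟨hs, hlt.ne'⟩
  exact ((tendsto_nhds_limUnder hf).mono_left hle).congr fun s => by rw [quot, hstar]

theorem HasRightDeriv.eventually_norm_sub_le (hf : g.HasRightDeriv f 0 t) {ε : ℝ} (hε : 0 < ε) :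
    ∀ᶠ s in g.rightFilter t, ‖f s - f t‖ ≤ ε * (g s - g t) := by
  filter_upwards [hf.norm.eventually_lt_const (by rwa [norm_zero]), eventually_rightFilter_lt]
    with s hs hlt
  rw [norm_div, Complex.norm_of_nonneg (sub_pos.2 hlt).le, div_lt_iff₀ (sub_pos.2 hlt)] at hs
  exact hs.le

theorem MemC.eq_of_hasRightDeriv_zero (hf : g.MemC T f)
    (hf' : ∀ t ∈ Ico 0 T, g.HasRightDeriv f 0 t) (ht : t ∈ Icc 0 T) : f t = f 0 := by
  have hbound : ∀ ε > 0, ‖f t - f 0‖ ≤ ε * g t - ε * g 0 := by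
    intro ε hε
    refine norm_sub_le_sub_of_eventually_nhdsGT (h := fun s => ε * g s)
      (fun s hs => hf.continuousWithinAt_Iio hs)
      (fun s _ => ((g.leftCont s).mono Iio_subset_Iic_self).const_mul ε) (fun s hs => ?_) t ht
    have hsmall := eventually_nhdsWithin_iff.1 ((hf' s hs).eventually_norm_sub_le hε)
    filter_upwards [nhdsWithin_le_nhds hsmall, Ioo_mem_nhdsGT hs.2] with u hu hsu
    rcases (g.mono hsu.1.le).eq_or_lt with heq | hlt
    · have hfu : f u = f s :=
        hf.eq_of_eq (Ico_subset_Icc_self hs) ⟨hs.1.trans hsu.1.le, hsu.2.le⟩ heq.symm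
      simp only [hfu, heq, sub_self, norm_zero, le_refl]
    · exact (hu hlt).trans_eq (mul_sub _ _ _)
  have hlim : Tendsto (fun ε : ℝ => ε * g t - ε * g 0) (𝓝[>] 0) (𝓝 0) :=
    Continuous.tendsto' (by fun_prop) _ _ (by ring) |>.mono_left nhdsWithin_le_nhds
  exact sub_eq_zero.1 <| norm_le_zero_iff.1 <|
    ge_of_tendsto hlim (eventually_nhdsWithin_of_forall hbound)

end RightDerivative

section Primitive

/-- The primitive `t ↦ ∫_{[0,t)} f dμ_g` of `f` with respect to `g`. -/
noncomputable def primitive (g : Derivator) (f : ℝ → ℂ) (t : ℝ) : ℂ := ∫ u in Ico 0 t, f u ∂g.mu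

variable {g : Derivator} {T s t : ℝ} {f : ℝ → ℂ}

theorem primitive_sub_primitive (hf : IntegrableOn f (Ico 0 T) g.mu) (ht : 0 ≤ t) (hts : t ≤ s)
    (hs : s ≤ T) : g.primitive f s - g.primitive f t = ∫ u in Ico t s, f u ∂g.mu := by
  rw [primitive, primitive, ← Ico_union_Ico_eq_Ico ht hts,
    setIntegral_union Ico_disjoint_Ico_same measurableSet_Ico
      (hf.mono_set (Ico_subset_Ico_right (hts.trans hs))) (hf.mono_set (Ico_subset_Ico ht hs)),
    add_sub_cancel_left]

theorem norm_primitive_sub_primitive (hf : IntegrableOn f (Ico 0 T) g.mu) (ht : t ∈ Icc 0 T)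
    (hs : s ∈ Icc 0 T) : ‖g.primitive f s - g.primitive f t‖ =
      ‖∫ u in Ico (min s t) (max s t), f u ∂g.mu‖ := by
  rcases le_total s t with hst | hts
  · rw [min_eq_left hst, max_eq_right hst, norm_sub_rev,
      primitive_sub_primitive hf hs.1 hst ht.2]
  · rw [min_eq_right hts, max_eq_left hts, primitive_sub_primitive hf ht.1 hts hs.2]

theorem memC_primitive (hf : IntegrableOn f (Ico 0 T) g.mu) : g.MemC T (g.primitive f) := by
  refine memC_iff_tendsto.2 fun t ht => ?_
  have hIcc : ∀ᶠ s in comap g.toFun (𝓝 (g t)) ⊓ 𝓟 (Icc 0 T), s ∈ Icc 0 T :=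
    mem_inf_of_right (mem_principal_self _)
  have hmu : Tendsto (fun s => g.mu (Ico (min s t) (max s t)))
      (comap g.toFun (𝓝 (g t)) ⊓ 𝓟 (Icc 0 T)) (𝓝 0) := by
    have hcont : Continuous fun x => ENNReal.ofReal |x - g t| :=
      ENNReal.continuous_ofReal.comp (by fun_prop)
    refine ((hcont.tendsto' _ 0 (by simp)).comp (tendsto_comap.mono_left inf_le_left)).congr
      fun s => ?_
    rw [mu_Ico, g.mono.map_max, g.mono.map_min, max_sub_min_eq_abs', Function.comp_apply]
  have hint : Tendsto (fun s => ∫ u in Ico (min s t) (max s t), f u ∂g.mu)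
      (comap g.toFun (𝓝 (g t)) ⊓ 𝓟 (Icc 0 T)) (𝓝 0) := by
    refine tendsto_setIntegral_of_subset hf ?_ hmu
    filter_upwards [hIcc] with s hs
    exact Ico_subset_Ico (le_min hs.1 ht.1) (max_le hs.2 ht.2)
  rw [tendsto_iff_norm_sub_tendsto_zero]
  refine (tendsto_zero_iff_norm_tendsto_zero.1 hint).congr' ?_
  filter_upwards [hIcc] with s hs
  exact (norm_primitive_sub_primitive hf ht hs).symm

theorem norm_primitive_le (hf : IntegrableOn f (Ico 0 T) g.mu) (ht : t ≤ T) :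
    ‖g.primitive f t‖ ≤ ∫ u in Ico 0 T, ‖f u‖ ∂g.mu :=
  (norm_integral_le_integral_norm _).trans <| setIntegral_mono_set hf.norm
    (Eventually.of_forall fun _ => norm_nonneg _) (Ico_subset_Ico_right ht).eventuallyLE

theorem setIntegral_Ico (hf : IntegrableOn f (Ico t s) g.mu) (hts : t < s) :
    ∫ u in Ico t s, f u ∂g.mu = f t * g.jump t + ∫ u in Ioo t s, f u ∂g.mu := by
  have hdisj : Disjoint {t} (Ioo t s) := disjoint_singleton_left.2 left_notMem_Ioo
  rw [← Ioo_union_left hts, union_comm] at hf ⊢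
  rw [setIntegral_union hdisj measurableSet_Ioo hf.left_of_union hf.right_of_union,
    integral_singleton, measureReal_def, mu_singleton, ENNReal.toReal_ofReal (g.jump_nonneg t),
    Complex.real_smul, mul_comm]

theorem tendsto_primitive_nhdsGT (hf : IntegrableOn f (Ico 0 T) g.mu) (ht : t ∈ Ico 0 T) :
    Tendsto (g.primitive f) (𝓝[>] t) (𝓝 (g.primitive f t + f t * g.jump t)) := by
  have hIoo : Tendsto (fun s => ∫ u in Ioo t s, f u ∂g.mu) (𝓝[>] t) (𝓝 0) :=
    tendsto_setIntegral_of_subset hf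
      (mem_of_superset (Ioo_mem_nhdsGT ht.2) fun s hs =>
        Ioo_subset_Ico_self.trans (Ico_subset_Ico ht.1 hs.2.le))
      (g.tendsto_mu_Ioo_nhdsGT t)
  rw [← add_zero (g.primitive f t + _)]
  refine (hIoo.const_add _).congr' ?_
  filter_upwards [Ioo_mem_nhdsGT ht.2] with s hs
  rw [add_assoc, ← setIntegral_Ico (hf.mono_set (Ico_subset_Ico ht.1 hs.2.le)) hs.1,
    ← primitive_sub_primitive hf ht.1 hs.1.le hs.2.le, add_sub_cancel]

theorem hasRightDeriv_primitive (hf : IntegrableOn f (Ico 0 T) g.mu) (ht : t ∈ Ico 0 T)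
    (hcont : t ∉ g.jumpSet → ContinuousWithinAt f (Ioi t) t) :
    g.HasRightDeriv (g.primitive f) (f t) t := by
  by_cases hj : t ∈ g.jumpSet
  · exact .of_tendsto hj (tendsto_primitive_nhdsGT hf ht)
  have hlittleO : (fun s => (∫ u in Ico t s, f u ∂g.mu) - (g s - g t) • f t)
      =o[g.rightFilter t] fun s => g s - g t := by
    refine Filter.Tendsto.integral_sub_linear_isLittleO_ae (l := 𝓝[≥] t)
      ((continuousWithinAt_Ioi_iff_Ici.1 (hcont hj)).mono_left inf_le_left)
      ⟨Ico t T, Ico_mem_nhdsGE ht.2,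
        (hf.mono_set (Ico_subset_Ico_left ht.1)).aestronglyMeasurable⟩
      (g.mu.finiteAt_nhdsWithin t _) ?_ _ ?_
    · exact (tendsto_const_nhdsWithin self_mem_Ici).Ico
        (rightFilter_le_nhdsGT.trans (nhdsWithin_mono _ Ioi_subset_Ici_self))
    · filter_upwards [rightFilter_le_nhdsGT self_mem_nhdsWithin] with s hs
      exact g.measureReal_mu_Ico (le_of_lt hs)
  have hquot := (Complex.isLittleO_ofReal_right.2 hlittleO).tendsto_div_nhds_zero.add_const (f t)
  rw [zero_add] at hquot
  refine hquot.congr' ?_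
  filter_upwards [eventually_rightFilter_sub_ne_zero, rightFilter_le_nhdsGT (Ioo_mem_nhdsGT ht.2)]
    with s hne hs
  rw [primitive_sub_primitive hf ht.1 hs.1.le hs.2.le, Complex.real_smul, sub_div,
    mul_div_cancel_left₀ _ hne, sub_add_cancel]

end Primitive

section MulJump

variable {g : Derivator} {t : ℝ} {A : Set ℝ} {p : ℝ → ℂ} {φ : ℂ → ℂ}

theorem finite_setOf_le_norm_mul_jump (hp : IntegrableOn p A g.mu) {c : ℝ} (hc : 0 < c) :
    {t ∈ A | c ≤ ‖p t * g.jump t‖}.Finite := by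
  set ν := (g.mu.restrict A).withDensity fun t => ‖p t‖ₑ
  by_contra hinf
  have hν : ν univ < ⊤ := by
    rw [withDensity_apply _ MeasurableSet.univ, Measure.restrict_univ]
    exact hp.hasFiniteIntegral
  refine (measure_lt_top_of_subset (subset_univ _) hν.ne).ne
    (Set.Infinite.meas_eq_top hinf ⟨ENNReal.ofReal c, by simpa using hc, fun t ht => ?_⟩)
  rw [withDensity_apply _ (measurableSet_singleton t), lintegral_singleton,
    Measure.restrict_apply (measurableSet_singleton t),
    inter_eq_left.2 (singleton_subset_iff.2 ht.1), mu_singleton, ← norm_ofReal_jump,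
    ofReal_norm, ← enorm_mul, ← ofReal_norm]
  exact ENNReal.ofReal_le_ofReal ht.2

theorem exists_bound_comp_mul_jump (hp : IntegrableOn p A g.mu)
    (hφ : ContinuousAt φ 0) : ∃ M : ℝ, ∀ t ∈ A, ‖φ (p t * g.jump t)‖ ≤ M := by
  obtain ⟨r, hr, hball⟩ := Metric.eventually_nhds_iff.1
    (hφ.norm.eventually_le_const (lt_add_one ‖φ 0‖))
  obtain ⟨M, hM⟩ :=
    ((finite_setOf_le_norm_mul_jump hp hr).image fun t => ‖φ (p t * g.jump t)‖).bddAbove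
  refine ⟨max M (‖φ 0‖ + 1), fun t ht => ?_⟩
  rcases le_or_gt r ‖p t * g.jump t‖ with hlarge | hsmall
  · exact le_max_of_le_left (hM (mem_image_of_mem _ ⟨ht, hlarge⟩))
  · exact le_max_of_le_right (hball (by rwa [dist_zero_right]))

theorem integrableOn_mul_comp_mul_jump (hA : MeasurableSet A)
    (hp : IntegrableOn p A g.mu) (hφm : Measurable φ) (hφ : ContinuousAt φ 0) :
    IntegrableOn (fun t => p t * φ (p t * g.jump t)) A g.mu := by
  obtain ⟨M, hM⟩ := exists_bound_comp_mul_jump hp hφ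
  refine Integrable.mul_bdd hp (c := M) ?_ (ae_restrict_of_forall_mem hA hM)
  exact (hφm.comp_aemeasurable (hp.aemeasurable.mul
    g.measurable_ofReal_jump.aemeasurable)).aestronglyMeasurable

theorem continuousWithinAt_mul_comp_mul_jump (hp : ContinuousWithinAt p (Ioi t) t)
    (ht : t ∉ g.jumpSet) (hφ : ContinuousAt φ 0) :
    ContinuousWithinAt (fun s => p s * φ (p s * g.jump s)) (Ioi t) t := by
  have hpj := hp.mul (continuousAt_ofReal_jump ht).continuousWithinAt
  refine hp.mul (ContinuousAt.comp_continuousWithinAt (f := fun s => p s * g.jump s) ?_ hpj)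
  rwa [ofReal_jump_eq_zero ht, mul_zero]

end MulJump

section Exponential

/-- The function `log (1 + z) / z`, extended by `1` at `0`. It turns an exponent `p` into the
integrand `p * logSlope (p * Δg)` of its `g`-exponential. -/
noncomputable def logSlope : ℂ → ℂ := dslope (fun z => Complex.log (1 + z)) 0

theorem hasDerivAt_log_one_add : HasDerivAt (fun z : ℂ => Complex.log (1 + z)) 1 0 := by
  simpa only [id, add_zero, div_one] using
    ((hasDerivAt_id (0 : ℂ)).const_add 1).clog (by simp)

theorem continuousAt_logSlope : ContinuousAt logSlope 0 :=
  continuousAt_dslope_same.2 hasDerivAt_log_one_add.differentiableAt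

theorem logSlope_zero : logSlope 0 = 1 := by
  rw [logSlope, dslope_same, hasDerivAt_log_one_add.deriv]

theorem mul_logSlope (z : ℂ) : z * logSlope z = Complex.log (1 + z) := by
  simpa only [logSlope, sub_zero, add_zero, Complex.log_one, smul_eq_mul] using
    sub_smul_dslope (fun z => Complex.log (1 + z)) 0 z

theorem measurable_logSlope : Measurable logSlope := by
  have hquot : Measurable fun z : ℂ => Complex.log (1 + z) / z :=
    (Complex.measurable_log.comp (measurable_const_add 1)).div measurable_id
  refine hquot.measurable_of_countable_ne ((countable_singleton 0).mono fun z hz => ?_)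
  contrapose! hz
  simp only [mem_singleton_iff] at hz
  rw [mem_ofPred_eq, not_not, ← mul_logSlope, mul_div_cancel_left₀ _ hz]

theorem continuousAt_inv_one_add : ContinuousAt (fun z : ℂ => (1 + z)⁻¹) 0 :=
  (continuousAt_const.add continuousAt_id).inv₀ (by simp)

/-- The exponent `⊖p = -p / (1 + p Δg)`, whose `g`-exponential is the inverse of that of `p`. -/
noncomputable def inverseExponent (g : Derivator) (p : ℝ → ℂ) (t : ℝ) : ℂ :=
  -(p t / (1 + p t * g.jump t))

/-- The exponents `p` whose `g`-exponential is `g`-differentiable with derivative `p * gexp p` at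
every point of `[0,T)`: to regressivity and integrability, which suffice almost everywhere, one adds
continuity from the right at the continuity points of `g`. -/
structure AdmissibleExponent (g : Derivator) (T : ℝ) (p : ℝ → ℂ) : Prop where
  regressive : g.Regressive T p
  integrableOn : IntegrableOn p (Ico 0 T) g.mu
  continuousWithinAt_Ioi : ∀ t ∈ Ico 0 T, t ∉ g.jumpSet → ContinuousWithinAt p (Ioi t) t

variable {g : Derivator} {T t : ℝ} {p f : ℝ → ℂ}

theorem expIntegrand_eq (p : ℝ → ℂ) :
    g.expIntegrand p = fun t => p t * logSlope (p t * g.jump t) := by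
  ext t
  rw [expIntegrand]
  split_ifs with ht
  · rw [← mul_logSlope, mul_right_comm, mul_div_cancel_right₀ _ (ofReal_jump_ne_zero ht)]
  · rw [ofReal_jump_eq_zero ht, mul_zero, logSlope_zero, mul_one]

theorem gexp_eq (p : ℝ → ℂ) (t : ℝ) :
    g.gexp p t = Complex.exp (g.primitive (g.expIntegrand p) t) :=
  rfl

theorem gexp_zero (p : ℝ → ℂ) : g.gexp p 0 = 1 := by
  rw [gexp, Ico_self, setIntegral_empty, Complex.exp_zero]

namespace AdmissibleExponent

theorem integrableOn_expIntegrand (hp : g.AdmissibleExponent T p) :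
    IntegrableOn (g.expIntegrand p) (Ico 0 T) g.mu := by
  rw [expIntegrand_eq]
  exact integrableOn_mul_comp_mul_jump measurableSet_Ico hp.integrableOn measurable_logSlope
    continuousAt_logSlope

theorem gexpDefined (hp : g.AdmissibleExponent T p) : g.GexpDefined T p :=
  ⟨hp.regressive, hp.integrableOn, hp.integrableOn_expIntegrand⟩

theorem memC_gexp (hp : g.AdmissibleExponent T p) : g.MemC T (g.gexp p) :=
  (memC_primitive hp.integrableOn_expIntegrand).comp_left Complex.continuous_exp

theorem exists_bound_gexp (hp : g.AdmissibleExponent T p) :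
    ∃ M : ℝ, ∀ t ∈ Icc 0 T, ‖g.gexp p t‖ ≤ M := by
  refine ⟨Real.exp (∫ u in Ico 0 T, ‖g.expIntegrand p u‖ ∂g.mu), fun t ht => ?_⟩
  rw [gexp_eq]
  exact (Complex.norm_exp_le_exp_norm _).trans
    (Real.exp_le_exp.2 (norm_primitive_le hp.integrableOn_expIntegrand ht.2))

theorem hasRightDeriv_primitive_expIntegrand (hp : g.AdmissibleExponent T p) (ht : t ∈ Ico 0 T) :
    g.HasRightDeriv (g.primitive (g.expIntegrand p)) (g.expIntegrand p t) t := by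
  refine hasRightDeriv_primitive hp.integrableOn_expIntegrand ht fun hj => ?_
  rw [expIntegrand_eq]
  exact continuousWithinAt_mul_comp_mul_jump (hp.continuousWithinAt_Ioi t ht hj) hj
    continuousAt_logSlope

theorem hasRightDeriv_gexp (hp : g.AdmissibleExponent T p) (ht : t ∈ Ico 0 T) :
    g.HasRightDeriv (g.gexp p) (p t * g.gexp p t) t := by
  by_cases hj : t ∈ g.jumpSet
  · refine .of_tendsto hj ?_
    have hlim := (Complex.continuous_exp.tendsto _).comp
      (tendsto_primitive_nhdsGT hp.integrableOn_expIntegrand ht)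
    rw [Complex.exp_add, ← gexp_eq, expIntegrand, if_pos hj,
      div_mul_cancel₀ _ (ofReal_jump_ne_zero hj),
      Complex.exp_log (hp.regressive t ⟨Ico_subset_Icc_self ht, hj⟩)] at hlim
    rwa [mul_one_add, mul_comm (g.gexp p t), mul_right_comm] at hlim
  · have hexp := (hp.hasRightDeriv_primitive_expIntegrand ht).comp_left_of_notMem_jumpSet
      (Complex.hasDerivAt_exp _) hj
    rwa [← gexp_eq, expIntegrand, if_neg hj, mul_comm] at hexp

theorem one_add_ne_zero (hp : g.AdmissibleExponent T p) (ht : t ∈ Icc 0 T) :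
    1 + p t * g.jump t ≠ 0 := by
  by_cases hj : t ∈ g.jumpSet
  · exact hp.regressive t ⟨ht, hj⟩
  · rw [ofReal_jump_eq_zero hj, mul_zero, add_zero]
    exact one_ne_zero

theorem exists_bound_inv_one_add (hp : g.AdmissibleExponent T p) :
    ∃ M : ℝ, ∀ t ∈ Icc 0 T, ‖(1 + p t * g.jump t)⁻¹‖ ≤ M := by
  have hT : g.mu {T} ≠ ⊤ := g.mu_singleton T ▸ ENNReal.ofReal_ne_top
  exact exists_bound_comp_mul_jump ((integrableOn_Icc_iff_integrableOn_Ico' hT).2 hp.integrableOn)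
    continuousAt_inv_one_add

theorem inverse (hp : g.AdmissibleExponent T p) : g.AdmissibleExponent T (g.inverseExponent p) where
  regressive t ht := by
    have hne : 1 + g.inverseExponent p t * g.jump t = (1 + p t * g.jump t)⁻¹ := by
      have := hp.regressive t ht
      rw [inverseExponent]
      field_simp
      ring
    rw [hne]
    exact inv_ne_zero (hp.regressive t ht)
  integrableOn :=
    (integrableOn_mul_comp_mul_jump measurableSet_Ico hp.integrableOn
      (measurable_const_add 1).inv continuousAt_inv_one_add).neg
  continuousWithinAt_Ioi t ht hj :=
    (continuousWithinAt_mul_comp_mul_jump (hp.continuousWithinAt_Ioi t ht hj) hj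
      continuousAt_inv_one_add).neg

theorem mul_gexp_inverseExponent (hp : g.AdmissibleExponent T p) (hf : g.MemC T f)
    (hf' : ∀ t ∈ Ico 0 T, g.HasRightDeriv f (p t * f t) t) (ht : t ∈ Icc 0 T) :
    f t * g.gexp (g.inverseExponent p) t = f 0 := by
  have hderiv : ∀ t ∈ Ico 0 T,
      g.HasRightDeriv (fun s => f s * g.gexp (g.inverseExponent p) s) 0 t := by
    intro t ht
    convert (hf' t ht).mul (hp.inverse.hasRightDeriv_gexp ht) using 1
    have hne := hp.one_add_ne_zero (Ico_subset_Icc_self ht)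
    rw [inverseExponent]
    field_simp
    ring
  rw [(hf.mul hp.inverse.memC_gexp).eq_of_hasRightDeriv_zero hderiv ht, gexp_zero, mul_one]

theorem gexp_inverseExponent (hp : g.AdmissibleExponent T p) (ht : t ∈ Icc 0 T) :
    g.gexp (g.inverseExponent p) t = (g.gexp p t)⁻¹ := by
  refine eq_inv_of_mul_eq_one_right ?_
  rw [hp.mul_gexp_inverseExponent hp.memC_gexp (fun t ht => hp.hasRightDeriv_gexp ht) ht, gexp_zero]

theorem eq_mul_gexp (hp : g.AdmissibleExponent T p) (hf : g.MemC T f)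
    (hf' : ∀ t ∈ Ico 0 T, g.HasRightDeriv f (p t * f t) t) (ht : t ∈ Icc 0 T) :
    f t = f 0 * g.gexp p t := by
  rw [← hp.mul_gexp_inverseExponent hf hf' ht, hp.gexp_inverseExponent ht, gexp_eq,
    inv_mul_cancel_right₀ (Complex.exp_ne_zero _)]

end AdmissibleExponent

end Exponential

section Wronskian

/-- The exponent `-P + Q Δg` of the first-order equation solved by the simplified `g`-Wronskian of
two solutions of `v_g'' + P v_g' + Q v = 0`. -/
noncomputable def wronskianExponent (g : Derivator) (P Q : ℝ → ℂ) (t : ℝ) : ℂ :=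
  -P t + Q t * g.jump t

variable {g : Derivator} {T t : ℝ} {P Q v y₁ y₂ : ℝ → ℂ}

theorem one_add_wronskianExponent (P Q : ℝ → ℂ) (t : ℝ) :
    1 + g.wronskianExponent P Q t * g.jump t =
      1 - P t * g.jump t + Q t * (g.jump t : ℂ) ^ 2 := by
  rw [wronskianExponent]
  ring

theorem inverseExponent_wronskianExponent (P Q : ℝ → ℂ) :
    g.inverseExponent (g.wronskianExponent P Q) = fun t => -((-P t + Q t * g.jump t) /
      (1 - P t * g.jump t + Q t * (g.jump t : ℂ) ^ 2)) := by
  ext t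
  rw [inverseExponent, one_add_wronskianExponent, wronskianExponent]

theorem MemBC.integrableOn (hP : g.MemBC T P) : IntegrableOn P (Ico 0 T) g.mu := by
  obtain ⟨M, hM⟩ := hP.2
  exact (IntegrableOn.of_bound isCompact_Icc.measure_lt_top hP.1.aemeasurable.aestronglyMeasurable M
    (ae_restrict_of_forall_mem measurableSet_Icc hM)).mono_set Ico_subset_Icc_self

theorem norm_ofReal_jump_le (ht : t ∈ Ico 0 T) : ‖(g.jump t : ℂ)‖ ≤ g T - g 0 := by
  rw [norm_ofReal_jump]
  exact (g.jump_le_sub ht.2).trans (sub_le_sub_left (g.mono ht.1) _)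

theorem admissibleExponent_wronskianExponent (hP : g.MemBC T P) (hQ : g.MemBC T Q)
    (hreg : ∀ t ∈ Icc 0 T ∩ g.jumpSet, 1 - P t * g.jump t + Q t * (g.jump t : ℂ) ^ 2 ≠ 0) :
    g.AdmissibleExponent T (g.wronskianExponent P Q) where
  regressive t ht := by
    rw [one_add_wronskianExponent]
    exact hreg t ht
  integrableOn := hP.integrableOn.neg.add <|
    Integrable.mul_bdd hQ.integrableOn (c := g T - g 0)
      g.measurable_ofReal_jump.aestronglyMeasurable
      (ae_restrict_of_forall_mem measurableSet_Ico fun _ ht => norm_ofReal_jump_le ht)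
  continuousWithinAt_Ioi _ ht hj := (hP.1.continuousWithinAt_Ioi ht hj).neg.add <|
    (hQ.1.continuousWithinAt_Ioi ht hj).mul (continuousAt_ofReal_jump hj).continuousWithinAt

theorem simpleWronskian_eq : g.simpleWronskian T y₁ y₂ = fun t =>
    y₁ t * g.iterDeriv T 1 y₂ t - y₂ t * g.iterDeriv T 1 y₁ t := by
  ext t
  rw [simpleWronskian, Matrix.det_fin_two_of]

namespace IsSolution

variable {f : ℝ → ℂ}

theorem memC (hv : g.IsSolution T P Q f v) : g.MemC T v :=
  hv.1.1.1.1

theorem memC_iterDeriv_one (hv : g.IsSolution T P Q f v) : g.MemC T (g.iterDeriv T 1 v) :=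
  hv.1.1.1.2.2

theorem hasRightDeriv (hv : g.IsSolution T P Q f v) (ht : t ∈ Ico 0 T) :
    g.HasRightDeriv v (g.iterDeriv T 1 v t) t :=
  (hv.1.1.1.2.1 t (Ico_subset_Icc_self ht)).hasRightDeriv ht

theorem hasRightDeriv_iterDeriv_one (hv : g.IsSolution T P Q f v) (ht : t ∈ Ico 0 T) :
    g.HasRightDeriv (g.iterDeriv T 1 v) (g.iterDeriv T 2 v t) t :=
  (hv.1.1.2.1 t (Ico_subset_Icc_self ht)).hasRightDeriv ht

theorem memC_simpleWronskian {f₁ f₂ : ℝ → ℂ} (hy₁ : g.IsSolution T P Q f₁ y₁)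
    (hy₂ : g.IsSolution T P Q f₂ y₂) : g.MemC T (g.simpleWronskian T y₁ y₂) := by
  rw [simpleWronskian_eq]
  exact (hy₁.memC.mul hy₂.memC_iterDeriv_one).sub (hy₂.memC.mul hy₁.memC_iterDeriv_one)

end IsSolution

section Homogeneous

variable (hy₁ : g.IsSolution T P Q (fun _ => 0) y₁) (hy₂ : g.IsSolution T P Q (fun _ => 0) y₂)
include hy₁ hy₂

theorem wronskian_eq (ht : t ∈ Icc 0 T) : g.wronskian T y₁ y₂ t =
    (1 - P t * g.jump t + Q t * (g.jump t : ℂ) ^ 2) * g.simpleWronskian T y₁ y₂ t := by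
  rw [simpleWronskian_eq, wronskian, Matrix.det_fin_three]
  simp only [Matrix.of_apply, Matrix.cons_val]
  linear_combination
    (y₁ t * g.jump t + (g.jump t : ℂ) ^ 2 * g.iterDeriv T 1 y₁ t) * hy₂.2 t ht -
      (y₂ t * g.jump t + (g.jump t : ℂ) ^ 2 * g.iterDeriv T 1 y₂ t) * hy₁.2 t ht

theorem hasRightDeriv_simpleWronskian (ht : t ∈ Ico 0 T) :
    g.HasRightDeriv (g.simpleWronskian T y₁ y₂)
      (g.wronskianExponent P Q t * g.simpleWronskian T y₁ y₂ t) t := by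
  have ht' := Ico_subset_Icc_self ht
  have hprod := ((hy₁.hasRightDeriv ht).mul (hy₂.hasRightDeriv_iterDeriv_one ht)).sub
    ((hy₂.hasRightDeriv ht).mul (hy₁.hasRightDeriv_iterDeriv_one ht))
  rw [simpleWronskian_eq]
  convert hprod using 1
  rw [wronskianExponent]
  linear_combination (y₂ t + g.jump t * g.iterDeriv T 1 y₂ t) * hy₁.2 t ht' -
    (y₁ t + g.jump t * g.iterDeriv T 1 y₁ t) * hy₂.2 t ht'

theorem continuousWithinAt_wronskian (hP : g.MemC T P) (hQ : g.MemC T Q) (ht : t ∈ Icc 0 T)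
    (hj : t ∉ g.jumpSet) : ContinuousWithinAt (g.wronskian T y₁ y₂) (Icc 0 T) t := by
  have hjump : ContinuousWithinAt (fun s => (g.jump s : ℂ)) (Icc 0 T) t :=
    (continuousAt_ofReal_jump hj).continuousWithinAt
  have hcoeff : ContinuousWithinAt
      (fun s => 1 - P s * g.jump s + Q s * (g.jump s : ℂ) ^ 2) (Icc 0 T) t :=
    (continuousWithinAt_const.sub ((hP.continuousWithinAt_Icc ht hj).mul hjump)).add
      ((hQ.continuousWithinAt_Icc ht hj).mul (hjump.pow 2))
  have hsimple := (hy₁.memC_simpleWronskian hy₂).continuousWithinAt_Icc ht hj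
  exact (hcoeff.mul hsimple).congr (fun s hs => wronskian_eq hy₁ hy₂ hs) (wronskian_eq hy₁ hy₂ ht)

variable (hp : g.AdmissibleExponent T (g.wronskianExponent P Q))
include hp

theorem simpleWronskian_eq_mul_gexp (ht : t ∈ Icc 0 T) : g.simpleWronskian T y₁ y₂ t =
    g.simpleWronskian T y₁ y₂ 0 * g.gexp (g.wronskianExponent P Q) t :=
  hp.eq_mul_gexp (hy₁.memC_simpleWronskian hy₂)
    (fun _ ht => hasRightDeriv_simpleWronskian hy₁ hy₂ ht) ht

theorem wronskian_ne_zero (h0 : g.simpleWronskian T y₁ y₂ 0 ≠ 0) (ht : t ∈ Icc 0 T) :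
    g.wronskian T y₁ y₂ t ≠ 0 := by
  rw [wronskian_eq hy₁ hy₂ ht, simpleWronskian_eq_mul_gexp hy₁ hy₂ hp ht,
    ← one_add_wronskianExponent]
  exact mul_ne_zero (hp.one_add_ne_zero ht) (mul_ne_zero h0 (Complex.exp_ne_zero _))

theorem inv_wronskian_eq (ht : t ∈ Icc 0 T) : (g.wronskian T y₁ y₂ t)⁻¹ =
    (g.simpleWronskian T y₁ y₂ 0 * (1 - P t * g.jump t + Q t * (g.jump t : ℂ) ^ 2))⁻¹ *
      g.gexp (g.inverseExponent (g.wronskianExponent P Q)) t := by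
  rw [wronskian_eq hy₁ hy₂ ht, simpleWronskian_eq_mul_gexp hy₁ hy₂ hp ht,
    hp.gexp_inverseExponent ht, mul_left_comm, ← mul_assoc, mul_inv]

theorem exists_bound_inv_wronskian : ∃ M : ℝ, ∀ t ∈ Icc 0 T, ‖(g.wronskian T y₁ y₂ t)⁻¹‖ ≤ M := by
  obtain ⟨A, hA⟩ := hp.exists_bound_inv_one_add
  obtain ⟨B, hB⟩ := hp.inverse.exists_bound_gexp
  refine ⟨‖(g.simpleWronskian T y₁ y₂ 0)⁻¹‖ * A * B, fun t ht => ?_⟩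
  rw [inv_wronskian_eq hy₁ hy₂ hp ht, ← one_add_wronskianExponent, mul_inv, norm_mul, norm_mul]
  have hA0 : 0 ≤ A := (norm_nonneg _).trans (hA t ht)
  gcongr
  exacts [hA t ht, hB t ht]

end Homogeneous

end Wronskian

end Derivator

theorem mainTheorem3 (g : Derivator) (T : ℝ) (hT : 0 < T)
    (h0 : (0 : ℝ) ∉ g.jumpSet ∪ g.leftEnds)
    (hTg : T ∉ g.rightEnds ∪ g.jumpSet ∪ g.constSet)
    (P Q : ℝ → ℂ) (hP : g.MemBC T P) (hQ : g.MemBC T Q)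
    (y₁ y₂ : ℝ → ℂ)
    (hy₁ : g.IsSolution T P Q (fun _ => 0) y₁)
    (hy₂ : g.IsSolution T P Q (fun _ => 0) y₂) :
    (∀ t ∈ Set.Icc 0 T, g.wronskian T y₁ y₂ t =
      (1 - P t * g.jump t + Q t * (g.jump t : ℂ) ^ 2) * g.simpleWronskian T y₁ y₂ t) ∧
    ((∀ t ∈ Set.Icc 0 T ∩ g.jumpSet,
        1 - P t * g.jump t + Q t * (g.jump t : ℂ) ^ 2 ≠ 0) →
      g.GexpDefined T (fun s => -P s + Q s * g.jump s) ∧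
      (∀ t ∈ Set.Icc 0 T, g.simpleWronskian T y₁ y₂ t =
        g.simpleWronskian T y₁ y₂ 0 * g.gexp (fun s => -P s + Q s * g.jump s) t) ∧
      (g.simpleWronskian T y₁ y₂ 0 ≠ 0 →
        (∀ t ∈ Set.Icc 0 T, g.wronskian T y₁ y₂ t ≠ 0) ∧
        g.GexpDefined T (fun s => -((-P s + Q s * g.jump s) /
          (1 - P s * g.jump s + Q s * (g.jump s : ℂ) ^ 2))) ∧
        (∀ t ∈ Set.Icc 0 T, (g.wronskian T y₁ y₂ t)⁻¹ =
          (g.simpleWronskian T y₁ y₂ 0 *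
            (1 - P t * g.jump t + Q t * (g.jump t : ℂ) ^ 2))⁻¹ *
          g.gexp (fun s => -((-P s + Q s * g.jump s) /
            (1 - P s * g.jump s + Q s * (g.jump s : ℂ) ^ 2))) t) ∧
        (∃ M : ℝ, ∀ t ∈ Set.Icc 0 T, ‖(g.wronskian T y₁ y₂ t)⁻¹‖ ≤ M) ∧
        (∀ t ∈ Set.Icc 0 T \ g.jumpSet,
          ContinuousWithinAt (fun s => (g.wronskian T y₁ y₂ s)⁻¹) (Set.Icc 0 T) t))) := by
  refine ⟨fun t ht => Derivator.wronskian_eq hy₁ hy₂ ht, fun hreg => ?_⟩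
  have hp := Derivator.admissibleExponent_wronskianExponent hP hQ hreg
  rw [← Derivator.inverseExponent_wronskianExponent]
  exact ⟨hp.gexpDefined, fun t ht => Derivator.simpleWronskian_eq_mul_gexp hy₁ hy₂ hp ht,
    fun hW => ⟨fun t ht => Derivator.wronskian_ne_zero hy₁ hy₂ hp hW ht,
      hp.inverse.gexpDefined, fun t ht => Derivator.inv_wronskian_eq hy₁ hy₂ hp ht,
      Derivator.exists_bound_inv_wronskian hy₁ hy₂ hp,
      fun t ht => (Derivator.continuousWithinAt_wronskian hy₁ hy₂ hP.1 hQ.1 ht.1 ht.2).inv₀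
        (Derivator.wronskian_ne_zero hy₁ hy₂ hp hW ht.1)⟩⟩
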